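/- Let $L$ be a frame. Let $\mathcal{C}L$ be its congruence biframe: the total part is the frame of all frame congruences on $L$ ordered by inclusion, the first part is $\{\nabla_a \mid a\in L\}$ and the second part is the subframe generated by $\{\Delta_a\mid a\in L\}$, where $\nabla_a=\langle(0,a)\rangle$ and $\Delta_a=\langle(a,1)\rangle$ are generated as congruences. For a frame homomorphism $f:L\to M$, $\mathcal{C}f$ sends a congruence $C$ to the congruence generated by $\{(f(x),f(y))\mid (x,y)\in C\}$. Let $\Sigma L$ be the spectrum of $L$, that is, its space of points, with open sets $U_a=\{p \mid p(a)=1\}$, $a\in L$. For a topological space $(X,\tau)$ let $\mathrm{Sk}\,X=(\sigma,\tau,\upsilon)$ be its Skula biframe, where $\sigma$ is the topology generated by the $\tau$-open sets and their complements and $\upsilon$ is the topology generated by the $\tau$-closed sets; $\mathrm{Sk}$ is a contravariant functor, sending continuous maps to inverse-image maps. For a biframe $M=(M_0,M_1,M_2)$ let $\mathrm{Spat}\,M$ be the biframe with total part the frame of opens of $\Sigma M_0$ and $i$-th part $\{U_a\mid a\in M_i\}$ ($i=1,2$), with unit $\sigma_M:M\to\mathrm{Spat}\,M$, $a\mapsto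 U_a$; $M$ is called spatial if $\sigma_M$ is an isomorphism. (A frame is called spatial if $a\mapsto U_a$ is an isomorphism onto the frame of opens of its spectrum.) A biframe $M$ is strictly zero-dimensional if every element of $M_1$ has a complement in $M_0$ lying in $M_2$, and these complements generate $M_2$. Then $\mathrm{Sk}\,\Sigma L$ is the spatial reflection of $\mathcal{C}L$: there is a biframe homomorphism $\rho_L:\mathcal{C}L\to\mathrm{Sk}\,\Sigma L$ with $\rho_L(\nabla_a)=U_a$ for all $a\in L$, the biframe $\mathrm{Sk}\,\Sigma L$ is spatial, and every biframe homomorphism from $\mathcal{C}L$ to a spatial biframe factors uniquely through $\rho_L$; likewise, on total parts, $\rho_L$ is the spatial reflection of the congruence frame in the category of frames. Furthermore, the functors $\mathrm{Sk}\circ\Sigma$ and $\mathrm{Spat}\circ\mathcal{C}$ from frames to strictly zero-dimensional biframes are naturally isomorphic, by an isomorphism $\varphi:\mathrm{Spat}\circ\mathcal{C}\to\mathrm{Sk}\circ\Sigma$ with $\varphi_L\circ\sigma_{\mathcal{C}L}=\rho_L$ for every $L$. -/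

import Mathlib

open CategoryTheory Opposite TopologicalSpace
open scoped Topology

universe u

/-! ### Frame congruences and the congruence frame -/

/-- A congruence on a frame `L`: an equivalence relation on `L` which is a subframe of `L × L`. -/
@[ext]
structure FrameCong (L : Type u) [Order.Frame L] where
  rel : L → L → Prop
  equiv : Equivalence rel
  rel_inf : ∀ {a b c d : L}, rel a b → rel c d → rel (a ⊓ c) (b ⊓ d)
  rel_sSup : ∀ S : Set (L × L), (∀ p ∈ S, rel p.1 p.2) →
    rel (sSup (Prod.fst '' S)) (sSup (Prod.snd '' S))

namespace FrameCong

variable {L M N : Type u} [Order.Frame L] [Order.Frame M] [Order.Frame N]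

theorem refl (C : FrameCong L) (a : L) : C.rel a a := C.equiv.refl a

theorem symm (C : FrameCong L) {a b : L} (h : C.rel a b) : C.rel b a := C.equiv.symm h

theorem trans (C : FrameCong L) {a b c : L} (h : C.rel a b) (h' : C.rel b c) : C.rel a c :=
  C.equiv.trans h h'

theorem rel_sup (C : FrameCong L) {a b c d : L} (h : C.rel a b) (h' : C.rel c d) :
    C.rel (a ⊔ c) (b ⊔ d) := by
  have := C.rel_sSup {(a, b), (c, d)} (by
    rintro p (rfl | rfl)
    · exact h
    · exact h')
  simpa [Set.image_pair] using this

/-- Congruences are ordered by inclusion. -/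
instance : PartialOrder (FrameCong L) where
  le C D := ∀ ⦃x y⦄, C.rel x y → D.rel x y
  le_refl _ _ _ h := h
  le_trans _ _ _ h h' _ _ hx := h' (h hx)
  le_antisymm C D h h' := by
    ext x y
    exact ⟨fun hx => h hx, fun hx => h' hx⟩

theorem le_def {C D : FrameCong L} : C ≤ D ↔ ∀ ⦃x y⦄, C.rel x y → D.rel x y := Iff.rfl

/-- Meets of congruences are intersections. -/
instance : InfSet (FrameCong L) where
  sInf 𝒞 :=
    { rel := fun x y => ∀ C ∈ 𝒞, C.rel x y
      equiv := ⟨fun x C _ => C.refl x, fun h C hC => C.symm (h C hC),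
        fun h h' C hC => C.trans (h C hC) (h' C hC)⟩
      rel_inf := fun h h' C hC => C.rel_inf (h C hC) (h' C hC)
      rel_sSup := fun S hS C hC => C.rel_sSup S fun p hp => hS p hp C hC }

theorem isGLB_sInf (𝒞 : Set (FrameCong L)) : IsGLB 𝒞 (sInf 𝒞) :=
  ⟨fun _ hC _ _ h => h _ hC, fun _ hD _ _ h C hC => hD hC h⟩

instance : CompleteLattice (FrameCong L) :=
  { completeLatticeOfInf (FrameCong L) isGLB_sInf with
    inf := fun C D =>
      { rel := fun x y => C.rel x y ∧ D.rel x y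
        equiv := ⟨fun x => ⟨C.refl x, D.refl x⟩, fun h => ⟨C.symm h.1, D.symm h.2⟩,
          fun h h' => ⟨C.trans h.1 h'.1, D.trans h.2 h'.2⟩⟩
        rel_inf := fun h h' => ⟨C.rel_inf h.1 h'.1, D.rel_inf h.2 h'.2⟩
        rel_sSup := fun S hS =>
          ⟨C.rel_sSup S fun p hp => (hS p hp).1, D.rel_sSup S fun p hp => (hS p hp).2⟩ }
    inf_le_left := fun _ _ _ _ h => h.1
    inf_le_right := fun _ _ _ _ h => h.2
    le_inf := fun _ _ _ h h' _ _ hx => ⟨h hx, h' hx⟩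
    top :=
      { rel := fun _ _ => True
        equiv := ⟨fun _ => trivial, fun _ => trivial, fun _ _ => trivial⟩
        rel_inf := fun _ _ => trivial
        rel_sSup := fun _ _ => trivial }
    le_top := fun _ _ _ _ => trivial
    bot :=
      { rel := fun x y => x = y
        equiv := eq_equivalence
        rel_inf := fun h h' => by rw [h, h']
        rel_sSup := fun S hS => by rw [Set.image_congr hS] }
    bot_le := fun D x y h => by
      have h : x = y := h
      subst h
      exact D.refl x }

theorem inf_rel {C D : FrameCong L} {x y : L} : (C ⊓ D).rel x y ↔ C.rel x y ∧ D.rel x y := Iff.rfl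

theorem bot_rel {x y : L} : (⊥ : FrameCong L).rel x y ↔ x = y := Iff.rfl

theorem rel_inf_sup (C : FrameCong L) {a b : L} (h : C.rel a b) : C.rel (a ⊓ b) (a ⊔ b) :=
  C.trans (by simpa using C.rel_inf h (C.refl b)) (by simpa using C.rel_sup (C.symm h) (C.refl b))

theorem eq_top_of_rel {C : FrameCong L} (h : C.rel ⊥ ⊤) : C = ⊤ := by
  refine top_le_iff.1 fun x y _ => ?_
  have key : ∀ z, C.rel ⊥ z := fun z => by simpa using C.rel_inf h (C.refl z)
  exact C.trans (C.symm (key x)) (key y)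

/-- The Heyting implication of congruences. -/
def imp (C D : FrameCong L) : FrameCong L where
  rel x y := ∀ a b, a ≤ b → C.rel a b → D.rel ((x ⊓ b) ⊔ a) ((y ⊓ b) ⊔ a)
  equiv := ⟨fun _ _ _ _ _ => D.refl _, fun h a b hab hC => D.symm (h a b hab hC),
    fun h h' a b hab hC => D.trans (h a b hab hC) (h' a b hab hC)⟩
  rel_inf {x y z w} h h' a b hab hC := by
    have := D.rel_inf (h a b hab hC) (h' a b hab hC)
    rw [← sup_inf_right, ← sup_inf_right, ← inf_inf_distrib_right, ← inf_inf_distrib_right] at this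
    exact this
  rel_sSup S hS a b hab hC := by
    have key := D.rel_sSup ((fun p : L × L => ((p.1 ⊓ b) ⊔ a, (p.2 ⊓ b) ⊔ a)) '' S) (by
      rintro _ ⟨p, hp, rfl⟩
      exact hS p hp a b hab hC)
    have key := D.rel_sup key (D.refl a)
    have aux : ∀ f : L × L → L,
        sSup (f '' S) ⊓ b ⊔ a = sSup ((fun p => (f p ⊓ b) ⊔ a) '' S) ⊔ a := by
      intro f
      apply le_antisymm
      · refine sup_le ?_ le_sup_right
        rw [sSup_inf_eq]
        refine iSup₂_le ?_
        rintro _ ⟨p, hp, rfl⟩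
        exact le_sup_of_le_left (le_sup_left.trans (le_sSup ⟨p, hp, rfl⟩))
      · refine sup_le (sSup_le ?_) le_sup_right
        rintro _ ⟨p, hp, rfl⟩
        exact sup_le_sup_right (inf_le_inf_right b (le_sSup (Set.mem_image_of_mem f hp))) a
    rw [Set.image_image, Set.image_image, ← aux Prod.fst, ← aux Prod.snd] at key
    exact key

theorem le_imp_iff (E C D : FrameCong L) : E ≤ imp C D ↔ E ⊓ C ≤ D := by
  constructor
  · rintro h x y ⟨hE, hC⟩
    have := h hE (x ⊓ y) (x ⊔ y) (inf_le_left.trans le_sup_left) (C.rel_inf_sup hC)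
    simpa using this
  · intro h x y hE a b hab hC
    apply h
    refine ⟨E.rel_sup (E.rel_inf hE (E.refl b)) (E.refl a), ?_⟩
    have key : ∀ z, C.rel (z ⊓ b ⊔ a) b := fun z => by
      have := C.rel_sup (C.refl (z ⊓ b)) hC
      simpa using this
    exact C.trans (key x) (C.symm (key y))

instance : Order.Frame (FrameCong L) :=
  .ofMinimalAxioms
    { inf_sSup_le_iSup_inf := fun C 𝒟 => by
        have : sSup 𝒟 ≤ imp C (⨆ D ∈ 𝒟, C ⊓ D) := by
          refine sSup_le fun D hD => (le_imp_iff _ _ _).2 ?_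
          rw [inf_comm]
          exact le_iSup₂_of_le D hD le_rfl
        rw [inf_comm]
        exact (le_imp_iff _ _ _).1 this }

/-- The principal congruence `⟨(a, b)⟩` generated by a pair. -/
def principal (a b : L) : FrameCong L := sInf {C | C.rel a b}

theorem principal_rel (a b : L) : (principal a b).rel a b := fun _ h => h

theorem principal_le {a b : L} {C : FrameCong L} : principal a b ≤ C ↔ C.rel a b :=
  ⟨fun h => h (principal_rel a b), fun h => sInf_le h⟩

/-- The closed congruence `∇_a = ⟨(0, a)⟩`. -/
def closed (a : L) : FrameCong L := principal ⊥ a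

/-- The open congruence `Δ_a = ⟨(a, 1)⟩`. -/
def opened (a : L) : FrameCong L := principal a ⊤

theorem closed_rel {a x y : L} : (closed a).rel x y ↔ x ⊔ a = y ⊔ a := by
  constructor
  · intro h
    refine h
      { rel := fun x y => x ⊔ a = y ⊔ a
        equiv := ⟨fun _ => rfl, fun h => h.symm, fun h h' => h.trans h'⟩
        rel_inf := fun h h' => by rw [sup_inf_right, sup_inf_right, h, h']
        rel_sSup := fun S hS => ?_ } (by simp)
    have aux : ∀ f g : L × L → L, (∀ p ∈ S, f p ⊔ a = g p ⊔ a) →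
        sSup (f '' S) ⊔ a ≤ sSup (g '' S) ⊔ a := by
      intro f g hfg
      refine sup_le (sSup_le ?_) le_sup_right
      rintro _ ⟨p, hp, rfl⟩
      exact (le_sup_left.trans (hfg p hp).le).trans
        (sup_le_sup_right (le_sSup (Set.mem_image_of_mem g hp)) a)
    exact le_antisymm (aux _ _ hS) (aux _ _ fun p hp => (hS p hp).symm)
  · intro h
    have key : ∀ z, (closed a).rel z (z ⊔ a) := fun z => by
      simpa using (closed a).rel_sup ((closed a).refl z) (principal_rel ⊥ a)
    exact (closed a).trans (key x) (h ▸ (closed a).symm (key y))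

theorem opened_rel {a x y : L} : (opened a).rel x y ↔ x ⊓ a = y ⊓ a := by
  constructor
  · intro h
    refine h
      { rel := fun x y => x ⊓ a = y ⊓ a
        equiv := ⟨fun _ => rfl, fun h => h.symm, fun h h' => h.trans h'⟩
        rel_inf := fun {p q s t} h h' => by
          rw [inf_inf_distrib_right p s, inf_inf_distrib_right q t, h, h']
        rel_sSup := fun S hS => ?_ } (by simp)
    have aux : ∀ f : L × L → L, sSup (f '' S) ⊓ a = sSup ((fun p => f p ⊓ a) '' S) := by
      intro f
      rw [sSup_inf_eq, iSup_image, sSup_image]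
    change sSup (Prod.fst '' S) ⊓ a = sSup (Prod.snd '' S) ⊓ a
    rw [aux, aux, Set.image_congr hS]
  · intro h
    have key : ∀ z, (opened a).rel (z ⊓ a) z := fun z => by
      simpa using (opened a).rel_inf ((opened a).refl z) (principal_rel a ⊤)
    exact (opened a).trans ((opened a).symm (key x)) (h ▸ key y)

theorem closed_le {a : L} {C : FrameCong L} : closed a ≤ C ↔ C.rel ⊥ a := principal_le

theorem opened_le {a : L} {C : FrameCong L} : opened a ≤ C ↔ C.rel a ⊤ := principal_le

/-- A pair `a ≤ b` related by `C` forces `∇_b ∧ Δ_a ≤ C`. -/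
theorem closed_inf_opened_le {C : FrameCong L} {a b : L} (h : C.rel a b) :
    closed b ⊓ opened a ≤ C := by
  rintro x y ⟨h1, h2⟩
  rw [closed_rel] at h1
  rw [opened_rel] at h2
  have h3 : C.rel (x ⊓ b) (y ⊓ b) :=
    C.trans (C.rel_inf (C.refl x) (C.symm h)) (h2 ▸ C.rel_inf (C.refl y) h)
  have h4 := C.rel_sup (C.refl (x ⊓ y)) h3
  have e1 : x ⊓ y ⊔ x ⊓ b = x := by rw [← inf_sup_left, ← h1, inf_sup_self]
  have e2 : x ⊓ y ⊔ y ⊓ b = y := by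
    rw [inf_comm x y, ← inf_sup_left, h1, inf_sup_self]
  rwa [e1, e2] at h4

theorem isCompl_closed_opened (a : L) : IsCompl (closed a) (opened a) := by
  refine IsCompl.of_eq ?_ ?_
  · exact le_bot_iff.1 (closed_inf_opened_le (C := ⊥) (a := a) (b := a) rfl)
  · refine eq_top_of_rel (trans _ (b := a) ?_ ?_)
    · exact closed_le.1 le_sup_left
    · exact opened_le.1 le_sup_right

/-- `a ↦ ∇_a` as a frame homomorphism `L → 𝒞 L`. -/
def nabla (L : Type u) [Order.Frame L] : FrameHom L (FrameCong L) where
  toFun := closed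
  map_top' := eq_top_of_rel (principal_rel _ _)
  map_inf' a b := by
    apply le_antisymm
    · have hm : ∀ {c d : L}, c ≤ d → closed c ≤ closed d := fun {c d} h => by
        rw [closed_le, closed_rel]; simp [h]
      exact le_inf (hm inf_le_left) (hm inf_le_right)
    · rintro x y ⟨h, h'⟩
      rw [closed_rel] at h h' ⊢
      rw [sup_inf_left, sup_inf_left, h, h']
  map_sSup' S := by
    apply le_antisymm
    · rw [closed_le]
      have := (sSup (closed '' S)).rel_sSup ((fun a => (⊥, a)) '' S) (by
        rintro _ ⟨a, ha, rfl⟩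
        exact closed_le.1 (le_sSup ⟨a, ha, rfl⟩))
      rw [Set.image_image, Set.image_image, Set.image_id'] at this
      refine trans _ ?_ this
      have e : sSup ((fun _ : L => (⊥ : L)) '' S) = ⊥ := by
        rw [sSup_image]; simp
      rw [e]
      exact refl _ _
    · refine sSup_le ?_
      rintro _ ⟨a, ha, rfl⟩
      rw [closed_le, closed_rel]
      simpa using le_sSup ha

/-- The inverse image of a congruence under `f × f`. -/
def comap (f : FrameHom L M) (D : FrameCong M) : FrameCong L where
  rel x y := D.rel (f x) (f y)
  equiv := ⟨fun _ => D.refl _, fun h => D.symm h, fun h h' => D.trans h h'⟩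
  rel_inf h h' := by
    rw [map_inf, map_inf]
    exact D.rel_inf h h'
  rel_sSup S hS := by
    have := D.rel_sSup ((fun p : L × L => (f p.1, f p.2)) '' S) (by
      rintro _ ⟨p, hp, rfl⟩
      exact hS p hp)
    rw [map_sSup, map_sSup, Set.image_image, Set.image_image]
    rwa [Set.image_image, Set.image_image] at this

/-- The congruence on `M` generated by the pairs `(f x, f y)` with `(x, y) ∈ C`. -/
def map (f : FrameHom L M) (C : FrameCong L) : FrameCong M :=
  sInf {D | ∀ x y, C.rel x y → D.rel (f x) (f y)}

theorem map_rel (f : FrameHom L M) {C : FrameCong L} {x y : L} (h : C.rel x y) :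
    (map f C).rel (f x) (f y) := fun _ hD => hD x y h

theorem gc_map_comap (f : FrameHom L M) : GaloisConnection (map f) (comap f) := fun _ _ =>
  ⟨fun h _ _ hx => h (map_rel f hx), fun h => sInf_le fun _ _ hx => h hx⟩

theorem map_closed (f : FrameHom L M) (a : L) : map f (closed a) = closed (f a) := by
  refine eq_of_forall_ge_iff fun D => ?_
  rw [gc_map_comap f, closed_le, closed_le]
  change D.rel (f ⊥) (f a) ↔ _
  rw [map_bot]

theorem map_opened (f : FrameHom L M) (a : L) : map f (opened a) = opened (f a) := by
  refine eq_of_forall_ge_iff fun D => ?_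
  rw [gc_map_comap f, opened_le, opened_le]
  change D.rel (f a) (f ⊤) ↔ _
  rw [map_top]

theorem map_inf_aux (f : FrameHom L M) {C D : FrameCong L} {a b x y : L}
    (hC : C.rel x y) (hD : D.rel a b) :
    (closed (f y) ⊓ opened (f x)) ⊓ (closed (f b) ⊓ opened (f a)) ≤ map f (C ⊓ D) := by
  have h : (C ⊓ D).rel ((a ⊔ x) ⊓ (b ⊓ y)) (b ⊓ y) := by
    constructor
    · have := C.rel_inf (C.rel_sup (C.refl a) hC) (C.refl (b ⊓ y))
      rwa [inf_eq_right.2 (inf_le_right.trans le_sup_right : b ⊓ y ≤ a ⊔ y)] at this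
    · have := D.rel_inf (D.rel_sup hD (D.refl x)) (D.refl (b ⊓ y))
      rwa [inf_eq_right.2 (inf_le_left.trans le_sup_left : b ⊓ y ≤ b ⊔ x)] at this
  refine le_trans ?_ (closed_inf_opened_le (map_rel f h))
  rintro s t ⟨⟨h1, h2⟩, h3, h4⟩
  rw [closed_rel] at h1 h3
  rw [opened_rel] at h2 h4
  constructor
  · rw [closed_rel, map_inf, sup_inf_left, sup_inf_left, h1, h3]
  · rw [opened_rel, map_inf, map_sup, ← inf_assoc, ← inf_assoc, inf_sup_left, inf_sup_left, h2, h4]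

/-- The frame homomorphism `𝒞 f : 𝒞 L → 𝒞 M`. -/
def mapHom (f : FrameHom L M) : FrameHom (FrameCong L) (FrameCong M) where
  toFun := map f
  map_top' := eq_top_of_rel (by
    have := map_rel f (C := ⊤) (x := ⊥) (y := ⊤) trivial
    rwa [map_bot, map_top] at this)
  map_inf' C D := by
    refine le_antisymm ((gc_map_comap f).monotone_l.map_inf_le C D) ?_
    have red : ∀ {E : FrameCong L} {P : FrameCong M},
        (∀ x y, x ≤ y → E.rel x y → closed (f y) ⊓ opened (f x) ≤ P) → map f E ≤ P := by
      intro E P h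
      refine sInf_le fun x y hxy => ?_
      have hle : x ⊓ y ≤ x ⊔ y := inf_le_left.trans le_sup_left
      have h1 := h _ _ hle (E.rel_inf_sup hxy)
      apply h1
      refine ⟨?_, ?_⟩
      · rw [closed_rel, map_sup]; simp
      · rw [opened_rel, map_inf]; simp
    rw [← le_himp_iff]
    refine red fun x y _ hC => ?_
    rw [le_himp_iff, inf_comm, ← le_himp_iff]
    refine red fun a b _ hD => ?_
    rw [le_himp_iff, inf_comm]
    exact map_inf_aux f hC hD
  map_sSup' S := by rw [(gc_map_comap f).l_sSup, sSup_image]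

theorem mapHom_id : mapHom (FrameHom.id L) = FrameHom.id (FrameCong L) := by
  ext1 C
  exact eq_of_forall_ge_iff fun D => gc_map_comap (FrameHom.id L) C D

theorem mapHom_comp (g : FrameHom M N) (f : FrameHom L M) :
    mapHom (g.comp f) = (mapHom g).comp (mapHom f) := by
  ext1 C
  refine eq_of_forall_ge_iff fun D => ?_
  change map (g.comp f) C ≤ D ↔ map g (map f C) ≤ D
  rw [gc_map_comap (g.comp f), gc_map_comap g, gc_map_comap f]
  rfl

end FrameCong

/-! ### Biframes -/

/-- `S` is a subframe of `L`: closed under finite meets and arbitrary joins. -/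
structure IsSubframe {L : Type u} [Order.Frame L] (S : Set L) : Prop where
  top_mem : ⊤ ∈ S
  inf_mem : ∀ {a b}, a ∈ S → b ∈ S → a ⊓ b ∈ S
  sSup_mem : ∀ {T : Set L}, T ⊆ S → sSup T ∈ S

/-- The subframe of `L` generated by `S`. -/
def subframeClosure {L : Type u} [Order.Frame L] (S : Set L) : Set L :=
  ⋂₀ {T | IsSubframe T ∧ S ⊆ T}

section Subframe

variable {L M : Type u} [Order.Frame L] [Order.Frame M]

theorem subset_subframeClosure (S : Set L) : S ⊆ subframeClosure S := fun _ h _ hT => hT.2 h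

theorem isSubframe_subframeClosure (S : Set L) : IsSubframe (subframeClosure S) where
  top_mem _ hT := hT.1.top_mem
  inf_mem ha hb T hT := hT.1.inf_mem (ha T hT) (hb T hT)
  sSup_mem hR T hT := hT.1.sSup_mem fun _ hx => hR hx T hT

theorem subframeClosure_subset {S T : Set L} (hT : IsSubframe T) (h : S ⊆ T) :
    subframeClosure S ⊆ T := fun _ hx => hx T ⟨hT, h⟩

theorem IsSubframe.preimage (f : FrameHom L M) {S : Set M} (hS : IsSubframe S) :
    IsSubframe (f ⁻¹' S) where
  top_mem := by simpa using hS.top_mem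
  inf_mem {a b} ha hb := by
    rw [Set.mem_preimage, map_inf]
    exact hS.inf_mem ha hb
  sSup_mem {T} hT := by
    rw [Set.mem_preimage, map_sSup]
    exact hS.sSup_mem (Set.image_subset_iff.2 hT)

theorem IsSubframe.image (f : FrameHom L M) {S : Set L} (hS : IsSubframe S) :
    IsSubframe (f '' S) where
  top_mem := ⟨⊤, hS.top_mem, map_top f⟩
  inf_mem := by
    rintro _ _ ⟨a, ha, rfl⟩ ⟨b, hb, rfl⟩
    exact ⟨a ⊓ b, hS.inf_mem ha hb, map_inf f a b⟩
  sSup_mem {T} hT := by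
    refine ⟨sSup (S ∩ f ⁻¹' T), hS.sSup_mem Set.inter_subset_left, ?_⟩
    rw [map_sSup, Set.image_inter_preimage, Set.inter_eq_right.2 hT]

theorem isSubframe_univ : IsSubframe (Set.univ : Set L) :=
  ⟨trivial, fun _ _ => trivial, fun _ => trivial⟩

theorem isSubframe_range (f : FrameHom L M) : IsSubframe (Set.range f) :=
  Set.image_univ (f := f) ▸ isSubframe_univ.image f

theorem image_subframeClosure_subset (f : FrameHom L M) (S : Set L) :
    f '' subframeClosure S ⊆ subframeClosure (f '' S) :=
  Set.image_subset_iff.2 <| subframeClosure_subset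
    ((isSubframe_subframeClosure _).preimage f)
    (Set.image_subset_iff.1 (subset_subframeClosure _))

theorem image_subframeClosure (f : FrameHom L M) (S : Set L) :
    f '' subframeClosure S = subframeClosure (f '' S) :=
  (image_subframeClosure_subset f S).antisymm <| subframeClosure_subset
    ((isSubframe_subframeClosure S).image f) (Set.image_mono (subset_subframeClosure S))

end Subframe

/-! ### Spatial frames -/

/-- The frame homomorphism `a ↦ U_a = {p | p a}` from a frame to the opens of its spectrum. -/
def unitHom (L : Type u) [Order.Frame L] : FrameHom L (Opens (Locale.PT L)) :=
  Locale.counitAppCont (Locale.of L)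

/-- A frame is spatial if `a ↦ U_a` is an isomorphism. -/
def IsSpatialFrame (L : Type u) [Order.Frame L] : Prop := Function.Bijective (unitHom L)

/-- `r : L → R` is a spatial reflection of the frame `L`: the frame `R` is spatial, and every frame
homomorphism from `L` to a spatial frame factors uniquely through `r`. -/
structure IsFrameSpatialReflection {L R : Type u} [Order.Frame L] [Order.Frame R]
    (r : FrameHom L R) : Prop where
  isSpatial : IsSpatialFrame R
  existsUnique : ∀ (M : Type u) [Order.Frame M], IsSpatialFrame M →
    ∀ g : FrameHom L M, ∃! h : FrameHom R M, h.comp r = g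

/-- A biframe `(L₀, L₁, L₂)`: a frame with two subframes which together generate it. -/
structure BiFrm where
  total : Type u
  [frame : Order.Frame total]
  part1 : Set total
  part2 : Set total
  isSubframe1 : IsSubframe part1
  isSubframe2 : IsSubframe part2
  generate : subframeClosure (part1 ∪ part2) = Set.univ

attribute [instance] BiFrm.frame

namespace BiFrm

/-- A biframe homomorphism: a frame homomorphism of total parts which respects both parts. -/
@[ext]
structure Hom (L M : BiFrm.{u}) where
  hom : FrameHom L.total M.total
  map1 : ∀ a ∈ L.part1, hom a ∈ M.part1
  map2 : ∀ a ∈ L.part2, hom a ∈ M.part2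

instance : Category BiFrm.{u} where
  Hom := Hom
  id L := ⟨FrameHom.id _, fun _ h => h, fun _ h => h⟩
  comp f g := ⟨g.hom.comp f.hom, fun a h => g.map1 _ (f.map1 a h), fun a h => g.map2 _ (f.map2 a h)⟩

@[ext]
theorem hom_ext {L M : BiFrm.{u}} {f g : L ⟶ M} (h : f.hom = g.hom) : f = g := Hom.ext h

/-- `L` is strictly zero-dimensional: every element of the first part is complemented, with its
complement in the second part, and these complements generate the second part. -/
def IsStrictlyZeroDim : ObjectProperty BiFrm.{u} := fun L =>
  (∀ a ∈ L.part1, ∃ b ∈ L.part2, IsCompl a b) ∧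
    subframeClosure {b | ∃ a ∈ L.part1, IsCompl a b} = L.part2

/-- The spatial reflection `Spat L` of a biframe as an object. The points of `L` are those of the
frame `L₀`; they carry the two topologies `{U_a | a ∈ L₁}` and `{U_a | a ∈ L₂}`, whose join is
`{U_a | a ∈ L₀}`, and `Spat L` is the biframe of this bitopological space. -/
def spatObj (L : BiFrm.{u}) : BiFrm.{u} where
  total := Opens (Locale.PT L.total)
  part1 := unitHom L.total '' L.part1
  part2 := unitHom L.total '' L.part2
  isSubframe1 := L.isSubframe1.image _
  isSubframe2 := L.isSubframe2.image _
  generate := by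
    rw [← Set.image_union, ← image_subframeClosure, L.generate, Set.image_univ]
    refine Set.eq_univ_of_forall ?_
    rintro ⟨_, a, rfl⟩
    exact ⟨a, rfl⟩

/-- The unit `σ_L : L → Spat L`, sending `a` to `U_a = {p | p a}`. -/
def spatUnit (L : BiFrm.{u}) : L ⟶ spatObj L where
  hom := unitHom L.total
  map1 a ha := ⟨a, ha, rfl⟩
  map2 a ha := ⟨a, ha, rfl⟩

/-- A biframe is spatial if `σ_L : L → Spat L` is an isomorphism. -/
def IsSpatial (L : BiFrm.{u}) : Prop := IsIso (spatUnit L)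

/-- `r : L → R` is a spatial reflection of `L`: the biframe `R` is spatial, and every biframe
homomorphism from `L` to a spatial biframe factors uniquely through `r`. -/
structure IsSpatialReflection {L R : BiFrm.{u}} (r : L ⟶ R) : Prop where
  isSpatial : IsSpatial R
  existsUnique : ∀ (M : BiFrm.{u}), IsSpatial M → ∀ g : L ⟶ M, ∃! h : R ⟶ M, r ≫ h = g

/-- The functor `Spat` on biframes; on morphisms it is the inverse image under `p ↦ p ∘ f`. -/
def spat : BiFrm.{u} ⥤ BiFrm.{u} where
  obj := spatObj
  map {L M} f :=
    { hom := Opens.comap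
        ⟨fun p : Locale.PT M.total => p.comp f.hom,
          continuous_def.2 <| by rintro s ⟨u, rfl⟩; exact ⟨f.hom u, rfl⟩⟩
      map1 := by
        rintro _ ⟨a, ha, rfl⟩
        exact ⟨f.hom a, f.map1 a ha, rfl⟩
      map2 := by
        rintro _ ⟨a, ha, rfl⟩
        exact ⟨f.hom a, f.map2 a ha, rfl⟩ }
  map_id _ := rfl
  map_comp _ _ := rfl

theorem IsStrictlyZeroDim.spat {L : BiFrm.{u}} (hL : IsStrictlyZeroDim L) :
    IsStrictlyZeroDim (spat.obj L) := by
  let σ := unitHom L.total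
  have hcompl : ∀ {a b : L.total}, IsCompl a b → IsCompl (σ a) (σ b) := fun h =>
    IsCompl.of_eq (by rw [← map_inf, h.inf_eq_bot, map_bot])
      (by rw [← map_sup, h.sup_eq_top, map_top])
  have hset : {B : Opens (Locale.PT L.total) | ∃ A ∈ σ '' L.part1, IsCompl A B} =
      σ '' {b | ∃ a ∈ L.part1, IsCompl a b} := by
    ext B
    constructor
    · rintro ⟨_, ⟨a, ha, rfl⟩, h⟩
      obtain ⟨b, -, hab⟩ := hL.1 a ha
      exact ⟨b, ⟨a, ha, hab⟩, (hcompl hab).right_unique h⟩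
    · rintro ⟨b, ⟨a, ha, hab⟩, rfl⟩
      exact ⟨σ a, ⟨a, ha, rfl⟩, hcompl hab⟩
  constructor
  · rintro _ ⟨a, ha, rfl⟩
    obtain ⟨b, hb, hab⟩ := hL.1 a ha
    exact ⟨σ b, ⟨b, hb, rfl⟩, hcompl hab⟩
  · change subframeClosure {B | ∃ A ∈ σ '' L.part1, IsCompl A B} = σ '' L.part2
    rw [hset, ← hL.2, image_subframeClosure]

end BiFrm

/-- The category of strictly zero-dimensional biframes and biframe homomorphisms. -/
abbrev StrZdBiFrm := BiFrm.IsStrictlyZeroDim.{u}.FullSubcategory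

/-- The functor `Spat`, on strictly zero-dimensional biframes. -/
def spatStrZd : StrZdBiFrm.{u} ⥤ StrZdBiFrm.{u} :=
  BiFrm.IsStrictlyZeroDim.lift (BiFrm.IsStrictlyZeroDim.ι ⋙ BiFrm.spat) fun L => L.property.spat

/-! ### The congruence biframe -/

/-- The congruence biframe `(𝒞 L, ∇L, ΔL)` of a frame. -/
def congBiFrm (L : Type u) [Order.Frame L] : BiFrm.{u} where
  total := FrameCong L
  part1 := Set.range FrameCong.closed
  part2 := subframeClosure (Set.range FrameCong.opened)
  isSubframe1 := isSubframe_range (FrameCong.nabla L)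
  isSubframe2 := isSubframe_subframeClosure _
  generate := by
    refine Set.eq_univ_of_forall fun C => ?_
    have hC : C = sSup {D | ∃ a b, a ≤ b ∧ C.rel a b ∧
        D = FrameCong.closed b ⊓ FrameCong.opened a} := by
      apply le_antisymm
      · intro x y hxy
        have hle : x ⊓ y ≤ x ⊔ y := inf_le_left.trans le_sup_left
        have hmem : FrameCong.closed (x ⊔ y) ⊓ FrameCong.opened (x ⊓ y) ∈ {D | ∃ a b, a ≤ b ∧
            C.rel a b ∧ D = FrameCong.closed b ⊓ FrameCong.opened a} :=
          ⟨x ⊓ y, x ⊔ y, hle, C.rel_inf_sup hxy, rfl⟩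
        refine le_sSup hmem ⟨?_, ?_⟩
        · rw [FrameCong.closed_rel]; simp
        · rw [FrameCong.opened_rel]; simp
      · refine sSup_le ?_
        rintro _ ⟨a, b, -, h, rfl⟩
        exact FrameCong.closed_inf_opened_le h
    rw [hC]
    refine (isSubframe_subframeClosure _).sSup_mem ?_
    rintro _ ⟨a, b, -, -, rfl⟩
    exact (isSubframe_subframeClosure _).inf_mem
      (subset_subframeClosure _ (Or.inl ⟨b, rfl⟩))
      (subset_subframeClosure _ (Or.inr (subset_subframeClosure _ ⟨a, rfl⟩)))

theorem isStrictlyZeroDim_congBiFrm (L : Type u) [Order.Frame L] :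
    BiFrm.IsStrictlyZeroDim (congBiFrm L) := by
  have hset : {B : FrameCong L | ∃ A ∈ Set.range FrameCong.closed, IsCompl A B} =
      Set.range FrameCong.opened := by
    ext B
    constructor
    · rintro ⟨_, ⟨a, rfl⟩, h⟩
      exact ⟨a, (FrameCong.isCompl_closed_opened a).right_unique h⟩
    · rintro ⟨a, rfl⟩
      exact ⟨_, ⟨a, rfl⟩, FrameCong.isCompl_closed_opened a⟩
  constructor
  · rintro _ ⟨a, rfl⟩
    exact ⟨FrameCong.opened a, subset_subframeClosure _ ⟨a, rfl⟩,
      FrameCong.isCompl_closed_opened a⟩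
  · exact congrArg subframeClosure hset

/-- The congruence functor `𝒞 : Frm ⥤ StrZdBiFrm`. -/
def congFunctor : Frm.{u} ⥤ StrZdBiFrm.{u} :=
  BiFrm.IsStrictlyZeroDim.lift
    { obj := fun L => congBiFrm L
      map := fun {L M} f =>
        { hom := FrameCong.mapHom f.hom
          map1 := by
            rintro _ ⟨a, rfl⟩
            exact ⟨f.hom a, (FrameCong.map_closed f.hom a).symm⟩
          map2 := by
            intro C hC
            refine subframeClosure_subset (isSubframe_subframeClosure _) ?_
              (image_subframeClosure_subset (FrameCong.mapHom f.hom) _ ⟨C, hC, rfl⟩)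
            rintro _ ⟨_, ⟨a, rfl⟩, rfl⟩
            exact subset_subframeClosure _ ⟨f.hom a, (FrameCong.map_opened f.hom a).symm⟩ }
      map_id := fun _ => BiFrm.hom_ext FrameCong.mapHom_id
      map_comp := fun f g => BiFrm.hom_ext (FrameCong.mapHom_comp g.hom f.hom) }
    fun L => isStrictlyZeroDim_congBiFrm L

/-! ### The Skula biframe -/

/-- The Skula modification of a space `X`: the same set with the Skula topology. -/
def Skula (X : Type u) : Type u := X

/-- The Skula topology is generated by the open sets of `X` and their complements. -/
instance Skula.instTopologicalSpace (X : Type u) [τ : TopologicalSpace X] :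
    TopologicalSpace (Skula X) :=
  generateFrom {U : Set X | IsOpen[τ] U ∨ IsOpen[τ] Uᶜ}

/-- The topology generated by the closed sets of `X`. -/
abbrev closedTop (X : Type u) [τ : TopologicalSpace X] : TopologicalSpace X :=
  generateFrom {U : Set X | IsOpen[τ] Uᶜ}

/-- The open sets of a space which are open for another topology form a subframe. -/
theorem isSubframe_opens {X : Type u} (τ : TopologicalSpace X) [TopologicalSpace X] :
    IsSubframe {U : Opens X | IsOpen[τ] (U : Set X)} where
  top_mem := @isOpen_univ X τ
  inf_mem ha hb := @IsOpen.inter X τ _ _ ha hb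
  sSup_mem {T} hT := by
    rw [Set.mem_ofPred_eq, Opens.coe_sSup]
    exact @isOpen_biUnion X _ τ _ _ fun U hU => hT hU

theorem mem_of_generateFrom {X : Type u} {g : Set (Set X)} [σ : TopologicalSpace X]
    (hσ : σ ≤ generateFrom g) {S : Set (Opens X)} (hS : IsSubframe S)
    (h : ∀ U : Opens X, (U : Set X) ∈ g → U ∈ S) {U : Opens X}
    (hU : IsOpen[generateFrom g] (U : Set X)) : U ∈ S := by
  suffices H : ∀ V : Set X, GenerateOpen g V → ∀ hV : IsOpen V, (⟨V, hV⟩ : Opens X) ∈ S from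
    H U hU U.2
  intro V hV
  induction hV with
  | basic s hs => exact fun hV => h _ hs
  | univ => exact fun _ => hS.top_mem
  | inter s t hs ht ihs iht =>
    exact fun _ => hS.inf_mem (ihs (hσ _ hs)) (iht (hσ _ ht))
  | sUnion T hT ih =>
    intro hV
    have e : (⟨⋃₀ T, hV⟩ : Opens X) = sSup {U : Opens X | (U : Set X) ∈ T} := by
      apply Opens.ext
      rw [Opens.coe_sSup]
      ext x
      simp only [Opens.coe_mk, Set.mem_sUnion, Set.mem_iUnion, Set.mem_ofPred_eq]
      constructor
      · rintro ⟨s, hs, hx⟩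
        exact ⟨⟨s, hσ _ (hT s hs)⟩, hs, hx⟩
      · rintro ⟨U, hU, hx⟩
        exact ⟨U, hU, hx⟩
    rw [e]
    exact hS.sSup_mem fun U hU => ih U hU U.2

/-- The Skula biframe `(σ, τ, υ)` of a space `(X, τ)`: here `σ` is the Skula topology and `υ` is
the topology generated by the `τ`-closed sets. -/
def skulaBiFrm (X : Type u) [τ : TopologicalSpace X] : BiFrm.{u} where
  total := Opens (Skula X)
  part1 := {U : Opens (Skula X) | IsOpen[τ] (U : Set (Skula X))}
  part2 := {U : Opens (Skula X) | IsOpen[closedTop X] (U : Set (Skula X))}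
  isSubframe1 := isSubframe_opens (X := Skula X) τ
  isSubframe2 := isSubframe_opens (X := Skula X) (closedTop X)
  generate := by
    refine Set.eq_univ_of_forall fun U => ?_
    refine mem_of_generateFrom (X := Skula X) le_rfl (isSubframe_subframeClosure _) ?_ U.2
    rintro V (hV | hV)
    · exact subset_subframeClosure _ (Or.inl hV)
    · exact subset_subframeClosure _ (Or.inr (isOpen_generateFrom_of_mem hV))

theorem isCompl_opens_iff {X : Type u} [TopologicalSpace X] (U V : Opens X) :
    IsCompl U V ↔ (V : Set X) = (U : Set X)ᶜ := by
  have h1 : IsCompl U V ↔ IsCompl (U : Set X) (V : Set X) := by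
    rw [isCompl_iff, isCompl_iff, disjoint_iff, disjoint_iff, codisjoint_iff, codisjoint_iff,
      SetLike.ext'_iff, SetLike.ext'_iff (p := U ⊔ V)]
    simp
  rw [h1, eq_comm]
  exact ⟨fun h => h.compl_eq, fun h => h ▸ isCompl_compl⟩

theorem isStrictlyZeroDim_skulaBiFrm (X : Type u) [τ : TopologicalSpace X] :
    BiFrm.IsStrictlyZeroDim (skulaBiFrm X) := by
  have hset : {B : Opens (Skula X) | ∃ A : Opens (Skula X), IsOpen[τ] (A : Set (Skula X)) ∧ IsCompl A B} =
      {B : Opens (Skula X) | IsOpen[τ] (B : Set (Skula X))ᶜ} := by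
    ext B
    constructor
    · rintro ⟨A, hA, h⟩
      rw [isCompl_opens_iff] at h
      have h' : (B : Set (Skula X))ᶜ = A := by rw [h, compl_compl]
      rw [Set.mem_ofPred_eq]
      exact Eq.mpr (congrArg (fun S : Set X => IsOpen[τ] S) h') hA
    · intro hB
      exact ⟨⟨(B : Set (Skula X))ᶜ, isOpen_generateFrom_of_mem (Or.inl hB)⟩, hB,
        (isCompl_opens_iff _ _).2 (compl_compl _).symm⟩
  constructor
  · intro (A : Opens (Skula X)) hA
    have hA' : IsOpen[τ] (A : Set (Skula X))ᶜᶜ :=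
      Eq.mpr (congrArg (fun S : Set X => IsOpen[τ] S) (compl_compl (A : Set (Skula X)))) hA
    exact ⟨⟨(A : Set (Skula X))ᶜ, isOpen_generateFrom_of_mem (Or.inr hA')⟩,
      isOpen_generateFrom_of_mem hA', (isCompl_opens_iff _ _).2 rfl⟩
  · refine (congrArg subframeClosure hset).trans (Set.Subset.antisymm ?_ ?_)
    · exact subframeClosure_subset (isSubframe_opens (X := Skula X) (closedTop X))
        fun U hU => isOpen_generateFrom_of_mem hU
    · intro (U : Opens (Skula X)) hU
      refine mem_of_generateFrom (U := U) (X := Skula X) (g := {U : Set X | IsOpen[τ] Uᶜ}) ?_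
        (isSubframe_subframeClosure _) (fun V hV => subset_subframeClosure _ hV) hU
      exact le_generateFrom fun V hV => isOpen_generateFrom_of_mem (Or.inr hV)

/-- A continuous map is continuous with respect to the Skula modifications. -/
def Skula.map {X Y : Type u} [TopologicalSpace X] [TopologicalSpace Y] (f : C(X, Y)) :
    C(Skula X, Skula Y) where
  toFun := f
  continuous_toFun := continuous_generateFrom_iff.2 <| by
    rintro U (hU | hU)
    · exact isOpen_generateFrom_of_mem (Or.inl (hU.preimage f.continuous))
    · exact isOpen_generateFrom_of_mem (Or.inr (hU.preimage f.continuous))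

theorem continuous_closedTop {X Y : Type u} [TopologicalSpace X] [TopologicalSpace Y]
    (f : C(X, Y)) : Continuous[closedTop X, closedTop Y] f := by
  refine (@continuous_generateFrom_iff X Y f (closedTop X) _).2 fun V hV => ?_
  exact isOpen_generateFrom_of_mem (hV.preimage f.continuous)

/-- The functor `Sk : Topᵒᵖ ⥤ StrZdBiFrm`, sending a continuous map to its inverse image map. -/
def skulaFunctor : TopCat.{u}ᵒᵖ ⥤ StrZdBiFrm.{u} :=
  BiFrm.IsStrictlyZeroDim.lift
    { obj := fun X => skulaBiFrm X.unop
      map := fun {X Y} f =>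
        { hom := Opens.comap (Skula.map f.unop.hom)
          map1 := fun _ hU => IsOpen.preimage f.unop.hom.continuous hU
          map2 := fun _ hU => 
            @Continuous.isOpen_preimage _ _ (closedTop Y.unop) (closedTop X.unop) _
              (continuous_closedTop f.unop.hom) _ hU }
      map_id := fun _ => rfl
      map_comp := fun _ _ => rfl }
    fun X => isStrictlyZeroDim_skulaBiFrm X.unop

/-- The spectrum `Σ`, as a functor `Frm ⥤ Topᵒᵖ`. -/
def specFunctor : Frm.{u} ⥤ TopCat.{u}ᵒᵖ :=
  Functor.rightOp (C := Frm.{u}) Locale.pt.{u}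

/-- The open set `U_a` of the spectrum, as an element of the Skula biframe of the spectrum. -/
def skulaOpen {L : Frm.{u}} (a : L) : (skulaBiFrm (Locale.PT L)).total :=
  ⟨{p : Locale.PT L | p a}, isOpen_generateFrom_of_mem (Or.inl ⟨a, rfl⟩)⟩

/-! Everything rests on identifying the points of `FrameCong L` with those of `L`. A point `p` of
`L` has a kernel congruence `pointKer p`, and the congruences not contained in it are the true ones
for a point `liftPoint p` of `FrameCong L`, which restricts to `p` along `nabla L`. Conversely, a
point of `FrameCong L` is determined by its values at the `∇_a`: each `Δ_a` is the complement of
`∇_a`, and together they generate (`point_ext`). Hence every point of the congruence frame is a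
`liftPoint`.

Under this identification the open set `U_C` becomes the union of the differences `U_y \ U_x` over
all `(x, y)` in `C`. These are Skula open, `∇_a` and `Δ_a` give `U_a` and its complement, and so `ρ
= toSkula` maps the total part and both parts onto those of the Skula biframe. Pulling opens back
along `liftPoint` is therefore an isomorphism from `Spat 𝒞 L` to `Sk Σ L`, and `ρ` is the unit
followed by it.

For the reflection property, `ρ` is surjective, its codomain is spatial, and every point of
`FrameCong L` factors through it. Points separate elements of a spatial frame, so any homomorphism
into one identifies whatever `ρ` identifies, and factors. Compatibility with the parts is automatic,
because `ρ` is onto on each of them. -/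

/-! ### Factoring frame homomorphisms through surjections -/

/-- A frame homomorphism factors through a surjective one with smaller kernel. -/
theorem FrameHom.exists_comp_eq {L M R : Type u} [Order.Frame L] [Order.Frame M] [Order.Frame R]
    (r : FrameHom L R) (hr : Function.Surjective r) (g : FrameHom L M)
    (hg : ∀ a b, r a = r b → g a = g b) : ∃ h : FrameHom R M, h.comp r = g := by
  let s := Function.surjInv hr
  have hs : ∀ x, r (s x) = x := Function.surjInv_eq hr
  -- The section `s` preserves no structure, but each required identity becomes true after applying
  -- `r` to the arguments of `g`, and `hg` then transfers it to `g`.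
  refine ⟨{ toFun := fun x => g (s x)
            map_inf' := fun x y => ?_
            map_top' := ?_
            map_sSup' := fun S => ?_ }, ?_⟩
  · rw [← map_inf]
    exact hg _ _ (by rw [map_inf, hs, hs, hs])
  · rw [← map_top g]
    exact hg _ _ (by rw [hs, map_top])
  · have key : g (s (sSup S)) = g (sSup (s '' S)) := hg _ _ (by
      rw [hs, map_sSup, Set.image_image]
      simp [hs])
    rw [key, map_sSup, Set.image_image]
  · ext a
    exact hg _ _ (hs _)

theorem FrameHom.comp_right_injective_of_surjective {L M R : Type u} [Order.Frame L]
    [Order.Frame M] [Order.Frame R] {r : FrameHom L R} (hr : Function.Surjective r)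
    {h h' : FrameHom R M} (e : h.comp r = h'.comp r) : h = h' := by
  ext x
  obtain ⟨a, rfl⟩ := hr x
  exact DFunLike.congr_fun e a

/-- A biframe homomorphism which is bijective on the total part and surjective on both parts is an
isomorphism. -/
theorem BiFrm.isIso_of_bijective {L M : BiFrm.{u}} (f : L ⟶ M) (hf : Function.Bijective f.hom)
    (h1 : M.part1 ⊆ f.hom '' L.part1) (h2 : M.part2 ⊆ f.hom '' L.part2) : IsIso f := by
  obtain ⟨h, hh⟩ := FrameHom.exists_comp_eq f.hom hf.2 (FrameHom.id L.total)
    fun _ _ e => hf.1 e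
  have hh' : ∀ a, h (f.hom a) = a := fun a => DFunLike.congr_fun hh a
  let g : M ⟶ L :=
    { hom := h
      map1 := fun b hb => by
        obtain ⟨a, ha, rfl⟩ := h1 hb
        rwa [hh']
      map2 := fun b hb => by
        obtain ⟨a, ha, rfl⟩ := h2 hb
        rwa [hh'] }
  refine ⟨g, BiFrm.hom_ext hh, BiFrm.hom_ext ?_⟩
  refine FrameHom.comp_right_injective_of_surjective hf.2 ?_
  ext a
  exact congrArg f.hom (hh' a)

/-! ### Spatiality -/

theorem unitHom_surjective (L : Type u) [Order.Frame L] : Function.Surjective (unitHom L) := by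
  rintro ⟨_, a, rfl⟩
  exact ⟨a, rfl⟩

theorem unitHom_eq_iff {L : Type u} [Order.Frame L] {a b : L} :
    unitHom L a = unitHom L b ↔ ∀ p : Locale.PT L, p a ↔ p b := by
  rw [← SetLike.coe_set_eq, Set.ext_iff]
  rfl

/-- Each `x` in `X` yields the point "contains `x`" of the frame of opens, and these points alone
separate opens. No sobriety is needed. -/
theorem isSpatialFrame_opens (X : Type u) [TopologicalSpace X] : IsSpatialFrame (Opens X) := by
  refine ⟨fun U V h => ?_, unitHom_surjective _⟩
  ext x
  exact unitHom_eq_iff.1 h (Locale.localePointOfSpacePoint X x)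

/-- The parts of `Spat L` are by construction the images of the parts of `L`, so only the total part
can obstruct invertibility. -/
theorem BiFrm.isSpatial_iff {L : BiFrm.{u}} : L.IsSpatial ↔ IsSpatialFrame L.total := by
  constructor
  · intro (h : IsIso (spatUnit L))
    refine ⟨fun a b hab => ?_, unitHom_surjective _⟩
    have e : ∀ a, (inv (spatUnit L)).hom (unitHom L.total a) = a := fun a =>
      DFunLike.congr_fun (congrArg BiFrm.Hom.hom (IsIso.hom_inv_id (spatUnit L))) a
    rw [← e a, hab, e b]
  · exact fun h => isIso_of_bijective _ h Set.Subset.rfl Set.Subset.rfl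

/-- A surjection onto a spatial frame through which every point of the source factors is a spatial
reflection. -/
theorem isFrameSpatialReflection_of_surjective {L R : Type u} [Order.Frame L] [Order.Frame R]
    {r : FrameHom L R} (hR : IsSpatialFrame R) (hr : Function.Surjective r)
    (hp : ∀ p : Locale.PT L, ∃ q : Locale.PT R, q.comp r = p) : IsFrameSpatialReflection r where
  isSpatial := hR
  existsUnique M _ hM g := by
    obtain ⟨h, hh⟩ := FrameHom.exists_comp_eq r hr g fun a b hab => hM.1 <|
      unitHom_eq_iff.2 fun p => by
        -- Points of the spatial frame `M` detect equality, and each of them pulls back along `g` to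
        -- a point of `L`, which factors through `r` and so cannot separate `a` from `b`.
        obtain ⟨q, hq⟩ := hp (p.comp g)
        have e : ∀ c, q (r c) = p (g c) := fun c => DFunLike.congr_fun hq c
        rw [← e, ← e, hab]
    exact ⟨h, hh, fun h' hh' =>
      FrameHom.comp_right_injective_of_surjective hr (hh'.trans hh.symm)⟩

/-- The factorization on total parts respects the parts because each element of a part of `R` lifts
to the same part of `L`, where `g` already behaves well. -/
theorem BiFrm.isSpatialReflection_of_isFrameSpatialReflection {L R : BiFrm.{u}} {r : L ⟶ R}
    (hr : IsFrameSpatialReflection r.hom) (h1 : R.part1 ⊆ r.hom '' L.part1)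
    (h2 : R.part2 ⊆ r.hom '' L.part2) : IsSpatialReflection r where
  isSpatial := isSpatial_iff.2 hr.isSpatial
  existsUnique M hM g := by
    obtain ⟨h, hh, hu⟩ := hr.existsUnique M.total (isSpatial_iff.1 hM) g.hom
    have hh' : ∀ a, h (r.hom a) = g.hom a := fun a => DFunLike.congr_fun hh a
    refine ⟨{ hom := h, map1 := fun b hb => ?_, map2 := fun b hb => ?_ }, BiFrm.hom_ext hh,
      fun k hk => BiFrm.hom_ext (hu _ (congrArg BiFrm.Hom.hom hk))⟩
    · obtain ⟨a, ha, rfl⟩ := h1 hb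
      rw [hh']
      exact g.map1 a ha
    · obtain ⟨a, ha, rfl⟩ := h2 hb
      rw [hh']
      exact g.map2 a ha

/-! ### Points of the congruence frame -/

namespace FrameCong

section Points

variable {L M : Type u} [Order.Frame L] [Order.Frame M]

/-- The kernel of a point, as a congruence. -/
def pointKer (p : Locale.PT L) : FrameCong L where
  rel x y := p x ↔ p y
  equiv := ⟨fun _ => Iff.rfl, fun h => h.symm, fun h h' => h.trans h'⟩
  rel_inf h h' := by
    rw [map_inf, map_inf]
    exact and_congr h h'
  rel_sSup S hS := by
    have e : ∀ f : L × L → L, p (sSup (f '' S)) ↔ ∃ s ∈ S, p (f s) := fun f => by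
      rw [map_sSup, Set.image_image, sSup_Prop_eq]
      simp [Prop.exists_iff]
    rw [e, e]
    exact exists_congr fun s => and_congr_right fun hs => hS s hs

/-- By symmetry of `C`, a pair separated by `p` may be oriented so that `p` holds at the second
entry. -/
theorem exists_of_not_le_pointKer {p : Locale.PT L} {C : FrameCong L} (h : ¬ C ≤ pointKer p) :
    ∃ x y, C.rel x y ∧ ¬ p x ∧ p y := by
  rw [le_def] at h
  push Not at h
  obtain ⟨x, y, hC, hxy⟩ := h
  have hxy : ¬ (p x ↔ p y) := hxy
  by_cases hx : p x
  · exact ⟨y, x, C.symm hC, fun hy => hxy ⟨fun _ => hy, fun _ => hx⟩, hx⟩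
  · exact ⟨x, y, hC, hx, by tauto⟩

/-- The point of the congruence frame induced by a point of the frame. -/
def liftPoint (p : Locale.PT L) : Locale.PT (FrameCong L) where
  toFun C := ¬ C ≤ pointKer p
  map_inf' C D := by
    refine propext ⟨fun h => ⟨fun hC => h (inf_le_left.trans hC),
      fun hD => h (inf_le_right.trans hD)⟩, ?_⟩
    rintro ⟨hC, hD⟩ h
    obtain ⟨x, y, hC, hx, hy⟩ := exists_of_not_le_pointKer hC
    obtain ⟨a, b, hD, ha, hb⟩ := exists_of_not_le_pointKer hD
    -- One pair in `C ⊓ D` that `p` separates: `C` replaces `a ⊔ x` by `a ⊔ y`, and `D` replaces it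
    -- by `b ⊔ x`; both lie above `b ⊓ y`. Yet `p` holds at `b ⊓ y` and fails at `a ⊔ x`.
    have hrel : (C ⊓ D).rel ((a ⊔ x) ⊓ (b ⊓ y)) (b ⊓ y) := by
      constructor
      · have := C.rel_inf (C.rel_sup (C.refl a) hC) (C.refl (b ⊓ y))
        rwa [inf_eq_right.2 (inf_le_right.trans le_sup_right : b ⊓ y ≤ a ⊔ y)] at this
      · have := D.rel_inf (D.rel_sup hD (D.refl x)) (D.refl (b ⊓ y))
        rwa [inf_eq_right.2 (inf_le_left.trans le_sup_left : b ⊓ y ≤ b ⊔ x)] at this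
    have key : p ((a ⊔ x) ⊓ (b ⊓ y)) ↔ p (b ⊓ y) := h hrel
    simp only [map_inf, map_sup] at key
    exact (key.2 ⟨hb, hy⟩).1.elim ha hx
  map_top' := by
    refine eq_true fun h => ?_
    have key : p ⊥ ↔ p ⊤ := h (x := ⊥) (y := ⊤) trivial
    simp at key
  map_sSup' S := by
    -- A join lies below `pointKer p` exactly when all its members do, so negation gives the
    -- required existential.
    rw [sSup_Prop_eq]
    simp [Prop.exists_iff]

theorem liftPoint_apply {p : Locale.PT L} {C : FrameCong L} :
    liftPoint p C ↔ ¬ C ≤ pointKer p := Iff.rfl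

theorem liftPoint_closed (p : Locale.PT L) (a : L) : liftPoint p (closed a) ↔ p a := by
  rw [liftPoint_apply, closed_le]
  change ¬ (p ⊥ ↔ p a) ↔ p a
  simp

theorem liftPoint_opened (p : Locale.PT L) (a : L) : liftPoint p (opened a) ↔ ¬ p a := by
  rw [liftPoint_apply, opened_le]
  change ¬ (p a ↔ p ⊤) ↔ ¬ p a
  simp

/-- A point of the congruence frame is determined by its values at the closed congruences. -/
theorem point_ext {q q' : Locale.PT (FrameCong L)} (h : ∀ a, q (closed a) ↔ q' (closed a)) :
    q = q' := by
  have hsub : IsSubframe {C : FrameCong L | q C = q' C} :=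
    { top_mem := by simp
      inf_mem := fun {C D} (hC : q C = q' C) (hD : q D = q' D) => by
        simp [hC, hD]
      sSup_mem := fun {T} hT => by
        change q (sSup T) = q' (sSup T)
        rw [map_sSup, map_sSup]
        exact congrArg sSup (Set.image_congr hT) }
  -- Points preserve complements, and the complement in `Prop` is negation.
  have hopen : ∀ (r : Locale.PT (FrameCong L)) (a : L), r (opened a) ↔ ¬ r (closed a) := by
    intro r a
    have h1 : r (closed a ⊓ opened a) = (r (closed a) ⊓ r (opened a)) := map_inf r _ _
    have h2 : r (closed a ⊔ opened a) = (r (closed a) ⊔ r (opened a)) := map_sup r _ _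
    rw [(isCompl_closed_opened a).inf_eq_bot, map_bot] at h1
    rw [(isCompl_closed_opened a).sup_eq_top, map_top] at h2
    have h1 : ¬ (r (closed a) ∧ r (opened a)) := fun hh => h1.ge hh
    have h2 : r (closed a) ∨ r (opened a) := h2.le trivial
    tauto
  have hall : (Set.univ : Set (FrameCong L)) ⊆ {C | q C = q' C} := by
    refine (congBiFrm L).generate.superset.trans ?_
    refine subframeClosure_subset hsub (Set.union_subset ?_ (subframeClosure_subset hsub ?_))
    · rintro _ ⟨a, rfl⟩
      exact propext (h a)
    · rintro _ ⟨a, rfl⟩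
      exact propext ((hopen q a).trans ((not_congr (h a)).trans (hopen q' a).symm))
  ext1 C
  exact hall (Set.mem_univ C)

/-- A point `q` is recovered from its restriction along `nabla L`, since the two agree on closed
congruences. -/
theorem liftPoint_surjective : Function.Surjective (liftPoint (L := L)) := fun q =>
  ⟨q.comp (nabla L), point_ext fun a => liftPoint_closed _ a⟩

theorem liftPoint_comp (f : FrameHom L M) (p : Locale.PT M) :
    liftPoint (p.comp f) = (liftPoint p).comp (mapHom f) := by
  refine point_ext fun a => (liftPoint_closed _ a).trans ?_
  change p (f a) ↔ liftPoint p (map f (closed a))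
  rw [map_closed, liftPoint_closed]

/-! ### The Skula topology on the spectrum and the homomorphism `ρ` -/

theorem isOpen_setOf_liftPoint (C : FrameCong L) :
    IsOpen ({p | liftPoint p C} : Set (Skula (Locale.PT L))) := by
  -- `C` escapes the kernel of `p` exactly when some pair `(x, y)` in `C` has `p` in `U_y` but not
  -- in `U_x`.
  have h : {p : Locale.PT L | liftPoint p C} =
      ⋃ (x : L) (y : L) (_ : C.rel x y), {p | ¬ p x} ∩ {p | p y} := by
    ext p
    simp only [Set.mem_iUnion]
    constructor
    · intro hp
      obtain ⟨x, y, hC, h⟩ := exists_of_not_le_pointKer hp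
      exact ⟨x, y, hC, h⟩
    · rintro ⟨x, y, hC, hx, hy⟩ (hle : C ≤ pointKer p)
      have hxy : p x ↔ p y := hle hC
      exact hx (hxy.2 hy)
  refine Eq.mpr (congrArg (IsOpen (X := Skula (Locale.PT L))) h) ?_
  refine isOpen_iUnion fun x => isOpen_iUnion fun y => isOpen_iUnion fun _ => IsOpen.inter ?_ ?_
  · exact isOpen_generateFrom_of_mem (Or.inr ⟨x, by ext p; exact not_not.symm⟩)
  · exact isOpen_generateFrom_of_mem (Or.inl ⟨y, rfl⟩)

/-- `liftPoint` as a continuous map from the Skula modification of the spectrum of `L`. -/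
def liftPointSkula (L : Type u) [Order.Frame L] :
    C(Skula (Locale.PT L), Locale.PT (FrameCong L)) where
  toFun := liftPoint
  continuous_toFun := continuous_def.2 <| by
    rintro _ ⟨C, rfl⟩
    exact isOpen_setOf_liftPoint C

/-- The frame homomorphism `𝒞 L → Sk Σ L` of total parts. -/
def toSkula (L : Type u) [Order.Frame L] :
    FrameHom (FrameCong L) (Opens (Skula (Locale.PT L))) :=
  (Opens.comap (liftPointSkula L)).comp (unitHom (FrameCong L))

theorem coe_toSkula_closed (a : L) :
    (toSkula L (closed a) : Set (Skula (Locale.PT L))) = {p : Locale.PT L | p a} :=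
  Set.ext fun p => liftPoint_closed p a

theorem coe_toSkula_opened (a : L) :
    (toSkula L (opened a) : Set (Skula (Locale.PT L))) = {p : Locale.PT L | p a}ᶜ :=
  Set.ext fun p => liftPoint_opened p a

theorem image_toSkula_part1 :
    toSkula L '' (congBiFrm L).part1 = (skulaBiFrm (Locale.PT L)).part1 := by
  apply Set.Subset.antisymm
  · rintro _ ⟨_, ⟨a, rfl⟩, rfl⟩
    exact ⟨a, (coe_toSkula_closed a).symm⟩
  · rintro U ⟨a, ha⟩
    exact ⟨closed a, ⟨a, rfl⟩, Opens.ext ((coe_toSkula_closed a).trans ha)⟩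

theorem image_toSkula_part2 :
    toSkula L '' (congBiFrm L).part2 = (skulaBiFrm (Locale.PT L)).part2 := by
  apply Set.Subset.antisymm
  · refine (image_subframeClosure (toSkula L) _).trans_subset
      (subframeClosure_subset (skulaBiFrm (Locale.PT L)).isSubframe2 ?_)
    rintro _ ⟨_, ⟨a, rfl⟩, rfl⟩
    refine isOpen_generateFrom_of_mem ⟨a, ?_⟩
    exact (compl_compl _).symm.trans (congrArg compl (coe_toSkula_opened a).symm)
  · intro (U : Opens (Skula (Locale.PT L))) hU
    refine mem_of_generateFrom (X := Skula (Locale.PT L)) (U := U)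
      (g := {U : Set (Locale.PT L) | IsOpen Uᶜ})
      (le_generateFrom fun V hV => isOpen_generateFrom_of_mem (Or.inr hV))
      ((congBiFrm L).isSubframe2.image (toSkula L)) ?_ hU
    rintro V ⟨a, ha⟩
    refine ⟨opened a, subset_subframeClosure _ ⟨a, rfl⟩, Opens.ext ?_⟩
    exact (coe_toSkula_opened a).trans ((congrArg compl ha).trans (compl_compl _))

theorem toSkula_surjective : Function.Surjective (toSkula L) := by
  rw [← Set.range_eq_univ, ← Set.univ_subset_iff]
  refine (skulaBiFrm (Locale.PT L)).generate.superset.trans ?_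
  refine subframeClosure_subset (isSubframe_range (toSkula L)) ?_
  rw [← image_toSkula_part1, ← image_toSkula_part2]
  exact Set.union_subset (Set.image_subset_range _ _) (Set.image_subset_range _ _)

theorem isFrameSpatialReflection_toSkula : IsFrameSpatialReflection (toSkula L) :=
  isFrameSpatialReflection_of_surjective (isSpatialFrame_opens _) toSkula_surjective fun q => by
    obtain ⟨p, rfl⟩ := liftPoint_surjective q
    -- Evaluation of Skula opens at `p`, composed with `toSkula`, is `liftPoint p` by definition.
    exact ⟨Locale.localePointOfSpacePoint (Skula (Locale.PT L)) p, rfl⟩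

end Points

end FrameCong

/-! ### The comparison of `Spat ∘ 𝒞` and `Sk ∘ Σ` -/

/-- The biframe homomorphism `ρ : 𝒞 L → Sk Σ L`. -/
def congToSkula (L : Type u) [Order.Frame L] : congBiFrm L ⟶ skulaBiFrm (Locale.PT L) where
  hom := FrameCong.toSkula L
  map1 C hC := FrameCong.image_toSkula_part1.subset ⟨C, hC, rfl⟩
  map2 C hC := FrameCong.image_toSkula_part2.subset ⟨C, hC, rfl⟩

/-- The biframe homomorphism `Spat 𝒞 L → Sk Σ L`. -/
def spatCongToSkula (L : Type u) [Order.Frame L] :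
    BiFrm.spatObj (congBiFrm L) ⟶ skulaBiFrm (Locale.PT L) where
  hom := Opens.comap (FrameCong.liftPointSkula L)
  map1 := by
    rintro _ ⟨C, hC, rfl⟩
    exact (congToSkula L).map1 C hC
  map2 := by
    rintro _ ⟨C, hC, rfl⟩
    exact (congToSkula L).map2 C hC

theorem isIso_spatCongToSkula (L : Type u) [Order.Frame L] : IsIso (spatCongToSkula L) := by
  refine BiFrm.isIso_of_bijective _ ⟨?_, ?_⟩ ?_ ?_
  · intro (U : Opens (Locale.PT (FrameCong L))) V h
    refine Opens.ext (Set.ext fun q => ?_)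
    -- Inverse image along a surjection is injective on subsets.
    obtain ⟨p, rfl⟩ := FrameCong.liftPoint_surjective q
    exact Set.ext_iff.1 (congrArg (fun W : Opens (Skula (Locale.PT L)) => (W : Set (Skula (Locale.PT L)))) h) p
  · intro U
    obtain ⟨C, rfl⟩ := FrameCong.toSkula_surjective U
    exact ⟨unitHom _ C, rfl⟩
  · refine FrameCong.image_toSkula_part1.superset.trans ?_
    rintro _ ⟨C, hC, rfl⟩
    exact ⟨unitHom _ C, ⟨C, hC, rfl⟩, rfl⟩
  · refine FrameCong.image_toSkula_part2.superset.trans ?_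
    rintro _ ⟨C, hC, rfl⟩
    exact ⟨unitHom _ C, ⟨C, hC, rfl⟩, rfl⟩

/-- This is the naturality square evaluated at an open `U` and a point `p`. -/
theorem spatCongToSkula_naturality {L M : Type u} [Order.Frame L] [Order.Frame M]
    (f : FrameHom L M) (U : Opens (Locale.PT (FrameCong L))) (p : Locale.PT M) :
    (FrameCong.liftPoint p).comp (FrameCong.mapHom f) ∈ U ↔
      FrameCong.liftPoint (p.comp f) ∈ U := by
  rw [FrameCong.liftPoint_comp]

/-- The natural isomorphism `Spat ∘ 𝒞 ≅ Sk ∘ Σ`. -/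
noncomputable def spatCongIso :
    congFunctor.{u} ⋙ spatStrZd.{u} ≅ specFunctor.{u} ⋙ skulaFunctor.{u} :=
  NatIso.ofComponents
    (fun L => ObjectProperty.isoMk _ (@asIso _ _ _ _ (spatCongToSkula L) (isIso_spatCongToSkula L)))
    fun {L M} f => by
      apply ObjectProperty.hom_ext
      refine BiFrm.hom_ext ?_
      ext1 U
      apply Opens.ext
      ext p
      exact spatCongToSkula_naturality f.hom U p

theorem mainTheorem11 :
    ∃ φ : congFunctor.{u} ⋙ spatStrZd.{u} ≅ specFunctor.{u} ⋙ skulaFunctor.{u},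
      ∀ L : Frm.{u},
        ∃ ρ : congBiFrm L ⟶ skulaBiFrm (Locale.PT L),
          BiFrm.IsSpatialReflection ρ ∧
          IsFrameSpatialReflection ρ.hom ∧
          (∀ a : L, ρ.hom (FrameCong.closed a) = skulaOpen a) ∧
          BiFrm.spatUnit (congBiFrm L) ≫ (φ.hom.app L).hom = ρ :=
  ⟨spatCongIso, fun L => ⟨congToSkula L,
    BiFrm.isSpatialReflection_of_isFrameSpatialReflection
      FrameCong.isFrameSpatialReflection_toSkula
      FrameCong.image_toSkula_part1.superset FrameCong.image_toSkula_part2.superset,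
    FrameCong.isFrameSpatialReflection_toSkula,
    -- The compatibility with the unit is definitional, `toSkula` being the unit followed by inverse
    -- image along `liftPoint`.
    fun a => Opens.ext (FrameCong.coe_toSkula_closed a), rfl⟩⟩
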